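/- Let $n\ge 4$, let $G=(N,A)$ be the complete directed graph on $N=\{1,\dots,n\}$, with $A=\{ij : i,j\in N,\ i\ne j\}$, and let $N_1=N\setminus\{1\}$. For $S\subseteq N$ let $\delta^+(S)$ (respectively $\delta^-(S)$) be the set of arcs that leave (respectively enter) $S$, let $A(S)$ be the set of arcs with both ends in $S$, and write $\delta^\pm(i)=\delta^\pm(\{i\})$. Let $\mathcal S_1$ be the family of all $S\subseteq N_1$ with $|S|\ge 2$. Let $$P_{\mathrm{AP}}=\Big\{x\in[0,1]^A : \sum_{a\in\delta^+(i)}x_a=1\ \text{ and }\ \sum_{a\in\delta^-(i)}x_a=1\ \text{ for all } i\in N\Big\}$$ be the assignment polytope, and let $\overline B=\{b\in\mathbb R_+^{N_1} : \sum_{i\in N_1}b_i=1\}$. For $b\in\overline B$ let $P_{\mathrm{SCF}}(b)$ be the projection onto the $x$-variables of the $b$-SCF relaxation, that is, the set of all $x\in P_{\mathrm{AP}}$ for which there is $f\in\mathbb R_+^A$ with $$\sum_{a\in\delta^+(i)}f_a-\sum_{a\in\delta^-(i)}f_a=\begin{cases}1 & i=1\\ -b_i & i\in N_1\end{cases}\qquad\text{and}\qquad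 f_a\le x_a\ \text{ for all } a\in A.$$ Then, for every $b\in\overline B$, $$P_{\mathrm{SCF}}(b)=\Big\{x\in P_{\mathrm{AP}} : \sum_{ij\in\delta^+(S)}x_{ij}\ge\sum_{i\in S}b_i\ \text{ for all } S\in\mathcal S_1\Big\}.$$ Moreover, for all $x\in P_{\mathrm{AP}}$ and $S\in\mathcal S_1$, the inequality $\sum_{ij\in\delta^+(S)}x_{ij}\ge\sum_{i\in S}b_i$ holds if and only if $\sum_{ij\in A(S)}x_{ij}\le|S|-\sum_{i\in S}b_i$, and hence $$P_{\mathrm{SCF}}(b)=\Big\{x\in P_{\mathrm{AP}} : \sum_{ij\in A(S)}x_{ij}\le|S|-\sum_{i\in S}b_i\ \text{ for all } S\in\mathcal S_1\Big\}.$$ The latter inequalities generalize the weak clique inequalities: the vector $b$ with all $b_i=\frac1{n-1}$ belongs to $\overline B$, for it the right-hand side $|S|-\sum_{i\in S}b_i$ equals $|S|-\frac{|S|}{n-1}$ for every $S\in\mathcal S_1$, and $P_{\mathrm{SCF}}(b)$ is the set of all $x\in P_{\mathrm{AP}}$ with $\sum_{ij\in A(S)}x_{ij}\le|S|-\frac{|S|}{n-1}$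 for all $S\in\mathcal S_1$. -/

import Mathlib

open scoped BigOperators

noncomputable section

/-- The arc set `A = {ij : i, j ∈ N, i ≠ j}` of the complete directed graph on the node set `V`. -/
abbrev Arc (V : Type*) := {p : V × V // p.1 ≠ p.2}

/-- The set `N₁` of the nodes other than the special node `r` (node `1` in the usual numbering). -/
abbrev N1 {V : Type*} (r : V) := {i : V // i ≠ r}

/-- `δ⁺(S)`: the arcs leaving `S`. -/
def deltaOut {V : Type*} [Fintype V] [DecidableEq V] (S : Finset V) : Finset (Arc V) :=
  Finset.univ.filter fun a => a.1.1 ∈ S ∧ a.1.2 ∉ S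

/-- `δ⁻(S)`: the arcs entering `S`. -/
def deltaIn {V : Type*} [Fintype V] [DecidableEq V] (S : Finset V) : Finset (Arc V) :=
  Finset.univ.filter fun a => a.1.1 ∉ S ∧ a.1.2 ∈ S

/-- `A(S)`: the arcs with both end nodes in `S`. -/
def arcsIn {V : Type*} [Fintype V] [DecidableEq V] (S : Finset V) : Finset (Arc V) :=
  Finset.univ.filter fun a => a.1.1 ∈ S ∧ a.1.2 ∈ S

/-- A set of nodes different from `r`, regarded as a set of nodes. -/
def nodes {V : Type*} {r : V} (S : Finset (N1 r)) : Finset V :=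
  S.map (Function.Embedding.subtype fun i => i ≠ r)

/-- The family `𝒮₁` of the subsets of `N₁` of size at least two. -/
def S1 {V : Type*} (r : V) : Set (Finset (N1 r)) := {S | 2 ≤ S.card}

/-- The (restricted) assignment polytope `P_AP`. -/
def PAP (V : Type*) [Fintype V] [DecidableEq V] : Set (Arc V → ℝ) :=
  {x | (∀ a, 0 ≤ x a ∧ x a ≤ 1) ∧
    (∀ i : V, ∑ a ∈ deltaOut {i}, x a = 1) ∧
    (∀ i : V, ∑ a ∈ deltaIn {i}, x a = 1)}

/-- The parameter set `{b ∈ ℝ₊^{N₁} : ∑ b_i = 1}`. -/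
def Bbar {V : Type*} [Fintype V] [DecidableEq V] (r : V) : Set (N1 r → ℝ) :=
  {b | (∀ i, 0 ≤ b i) ∧ ∑ i, b i = 1}

/-- The polyhedron `Q_SCF(b)` of the linear relaxation of the `b`-SCF formulation. -/
def QSCF {V : Type*} [Fintype V] [DecidableEq V] (r : V) (b : N1 r → ℝ) :
    Set ((Arc V → ℝ) × (Arc V → ℝ)) :=
  {q | q.1 ∈ PAP V ∧ (∀ a, 0 ≤ q.2 a) ∧
    (∑ a ∈ deltaOut {r}, q.2 a - ∑ a ∈ deltaIn {r}, q.2 a = 1) ∧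
    (∀ i : N1 r, ∑ a ∈ deltaOut {i.1}, q.2 a - ∑ a ∈ deltaIn {i.1}, q.2 a = -b i) ∧
    (∀ a, q.2 a ≤ q.1 a)}

/-- `P_SCF(b)`, the projection of `Q_SCF(b)` onto the `x`-variables. -/
def PSCF {V : Type*} [Fintype V] [DecidableEq V] (r : V) (b : N1 r → ℝ) : Set (Arc V → ℝ) :=
  Prod.fst '' QSCF r b

/-- The parameter `b` with all entries equal to `1 / (n - 1)`, where `n` is the number of nodes. -/
def uniformB {V : Type*} [Fintype V] (r : V) : N1 r → ℝ :=
  fun _ => 1 / ((Fintype.card V : ℝ) - 1)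

end

/-!
For a fixed `x ∈ P_AP`, the existence of the flow `f` is a feasibility problem for a flow with
capacities `x` and demands `-1` at `r` and `b i` at the other nodes, so the Hoffman–Gale theorem
(`exists_netInflow_eq_iff_forall_cut`) turns it into cut inequalities. A set that contains `r` has
nonpositive demand and a single node is entered by arcs of total capacity `1`, so only the sets in
`𝒮₁` matter. Summing the assignment equations over `S` trades `x(δ⁻(S))` for `x(δ⁺(S))`, and then
for `|S| - x(A(S))`.

For the Hoffman–Gale theorem, project the demand orthogonally onto the compact convex set of net
inflows of feasible flows. At the projection, every arc along which the residual demand increases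
is at its upper bound and every arc along which it decreases is at its lower bound. So the cut
condition, applied to the set where the residual is largest, makes that residual nonpositive.
-/

section Flow

variable {V E R : Type*} [DecidableEq V] [Fintype E]

/-- The net inflow of a flow `f` at each node of the directed multigraph with arc set `E`, where
the arc `a` goes from `src a` to `tgt a`; parallel arcs and loops are allowed. -/
def netInflow [Ring R] (src tgt : E → V) : (E → R) →ₗ[R] (V → R) :=
  LinearMap.pi fun i => ∑ a with tgt a = i, LinearMap.proj a - ∑ a with src a = i, LinearMap.proj a

lemma netInflow_apply [Ring R] (src tgt : E → V) (f : E → R) (i : V) :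
    netInflow src tgt f i = ∑ a with tgt a = i, f a - ∑ a with src a = i, f a := by
  simp [netInflow]

lemma sum_mul_netInflow [Fintype V] [Ring R] (src tgt : E → V) (y : V → R) (f : E → R) :
    ∑ i, y i * netInflow src tgt f i = ∑ a, (y (tgt a) - y (src a)) * f a := by
  have sum_fiberwise (p : E → V) : ∑ i, y i * ∑ a with p a = i, f a = ∑ a, y (p a) * f a := by
    simp only [Finset.mul_sum, Finset.sum_filter, mul_ite, mul_zero]
    rw [Finset.sum_comm]
    simp
  simp only [netInflow_apply, mul_sub, sub_mul, Finset.sum_sub_distrib, sum_fiberwise]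

lemma sum_netInflow [Ring R] (src tgt : E → V) (f : E → R) (S : Finset V) :
    ∑ i ∈ S, netInflow src tgt f i =
      ∑ a with src a ∉ S ∧ tgt a ∈ S, f a - ∑ a with src a ∈ S ∧ tgt a ∉ S, f a := by
  simp only [netInflow_apply, Finset.sum_filter, ← Finset.sum_sub_distrib]
  rw [Finset.sum_comm]
  refine Finset.sum_congr rfl fun a _ => ?_
  by_cases hs : src a ∈ S <;> by_cases ht : tgt a ∈ S <;> simp [hs, ht]

lemma sum_univ_netInflow [Fintype V] [Ring R] (src tgt : E → V) (f : E → R) :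
    ∑ i, netInflow src tgt f i = 0 := by
  simp [sum_netInflow]

lemma exists_mem_forall_sum_sub_mul_sub_nonpos {ι : Type*} [Fintype ι] {K : Set (ι → ℝ)}
    (hne : K.Nonempty) (hK : IsCompact K) (hconv : Convex ℝ K) (u : ι → ℝ) :
    ∃ v ∈ K, ∀ w ∈ K, ∑ i, (u i - v i) * (w i - v i) ≤ 0 := by
  let L := (EuclideanSpace.equiv ι ℝ).symm
  have hconv' : Convex ℝ (L '' K) := hconv.linear_image L.toLinearMap
  obtain ⟨_, ⟨v, hv, rfl⟩, hmin⟩ := exists_norm_eq_iInf_of_complete_convex (hne.image L)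
    (hK.image L.continuous).isComplete hconv' (L u)
  refine ⟨v, hv, fun w hw => ?_⟩
  have h := (norm_eq_iInf_iff_real_inner_le_zero hconv' ⟨v, hv, rfl⟩).1 hmin _ ⟨w, hw, rfl⟩
  simpa [L, PiLp.inner_apply, mul_comm] using h

lemma exists_flow_complementary_slackness [Finite V] (src tgt : E → V) (d : V → ℝ) {l u : E → ℝ}
    (hlu : l ≤ u) :
    ∃ f ∈ Set.Icc l u, ∃ e : V → ℝ, e = d - netInflow src tgt f ∧
      ∀ a, (e (src a) < e (tgt a) → f a = u a) ∧ (e (tgt a) < e (src a) → f a = l a) := by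
  classical
  have := Fintype.ofFinite V
  have hcont : Continuous (netInflow (R := ℝ) src tgt) :=
    LinearMap.continuous_of_finiteDimensional _
  obtain ⟨_, ⟨f, hf, rfl⟩, hmin⟩ := exists_mem_forall_sum_sub_mul_sub_nonpos
    ((Set.nonempty_Icc.2 hlu).image (netInflow src tgt))
    (isCompact_Icc.image hcont)
    ((convex_Icc l u).linear_image (netInflow src tgt)) d
  set e := d - netInflow src tgt f with he
  have slack (a : E) {t : ℝ} (ht : t ∈ Set.Icc (l a) (u a)) :
      (e (tgt a) - e (src a)) * (t - f a) ≤ 0 := by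
    have hmem : f + Pi.single a (t - f a) ∈ Set.Icc l u := by
      rw [← Set.pi_univ_Icc] at hf ⊢
      intro b _
      obtain rfl | hb := eq_or_ne b a
      · simpa using ht
      · simpa [hb] using hf b
    have h := hmin _ ⟨_, hmem, rfl⟩
    have hdiff (i : V) : netInflow src tgt (f + Pi.single a (t - f a)) i - netInflow src tgt f i =
        netInflow src tgt (Pi.single a (t - f a)) i := by simp
    simp only [hdiff] at h
    calc (e (tgt a) - e (src a)) * (t - f a)
        = ∑ b, (e (tgt b) - e (src b)) * (Pi.single a (t - f a) : E → ℝ) b := by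
          simp [Pi.single_apply]
      _ = ∑ i, e i * netInflow src tgt (Pi.single a (t - f a)) i :=
          (sum_mul_netInflow src tgt e _).symm
      _ ≤ 0 := h
  refine ⟨f, hf, e, he, fun a => ⟨fun h => ?_, fun h => ?_⟩⟩
  · exact (hf.2 a).antisymm <| sub_nonpos.1 <|
      nonpos_of_mul_nonpos_right (slack a (Set.right_mem_Icc.2 (hlu a))) (sub_pos.2 h)
  · exact ge_antisymm (hf.1 a) <| sub_nonneg.1 <|
      nonneg_of_mul_nonpos_right (slack a (Set.left_mem_Icc.2 (hlu a))) (sub_neg.2 h)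

lemma residual_nonpos_of_complementary_slackness [Finite V] {src tgt : E → V} {d : V → ℝ}
    {l u f : E → ℝ} {e : V → ℝ} (he : e = d - netInflow src tgt f)
    (hslack : ∀ a, (e (src a) < e (tgt a) → f a = u a) ∧ (e (tgt a) < e (src a) → f a = l a))
    (hcut : ∀ S : Finset V, ∑ i ∈ S, d i ≤
      ∑ a with src a ∉ S ∧ tgt a ∈ S, u a - ∑ a with src a ∈ S ∧ tgt a ∉ S, l a) (i : V) :
    e i ≤ 0 := by
  have := Fintype.ofFinite V
  obtain ⟨m, -, hm⟩ := Finset.exists_max_image Finset.univ e ⟨i, Finset.mem_univ i⟩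
  let S : Finset V := {j | e j = e m}
  have eq_max {j : V} (hj : j ∈ S) : e j = e m := by simpa [S] using hj
  have lt_max {j : V} (hj : j ∉ S) : e j < e m :=
    (hm j (Finset.mem_univ j)).lt_of_ne (by simpa [S] using hj)
  have enter : ∑ a with src a ∉ S ∧ tgt a ∈ S, f a = ∑ a with src a ∉ S ∧ tgt a ∈ S, u a := by
    refine Finset.sum_congr rfl fun a ha => (hslack a).1 ?_
    obtain ⟨hs, ht⟩ := (Finset.mem_filter.1 ha).2
    exact (lt_max hs).trans_eq (eq_max ht).symm
  have leave : ∑ a with src a ∈ S ∧ tgt a ∉ S, f a = ∑ a with src a ∈ S ∧ tgt a ∉ S, l a := by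
    refine Finset.sum_congr rfl fun a ha => (hslack a).2 ?_
    obtain ⟨hs, ht⟩ := (Finset.mem_filter.1 ha).2
    exact (lt_max ht).trans_eq (eq_max hs).symm
  have card_mul_max : (S.card : ℝ) * e m ≤ 0 := calc
    (S.card : ℝ) * e m = ∑ j ∈ S, e j := by simp [Finset.sum_congr rfl fun _ => eq_max]
    _ = ∑ j ∈ S, d j - ∑ j ∈ S, netInflow src tgt f j := by simp [he]
    _ ≤ 0 := by rw [sum_netInflow, enter, leave]; exact sub_nonpos.2 (hcut S)
  have card_pos : (0 : ℝ) < S.card := by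
    exact_mod_cast Finset.card_pos.2 ⟨m, by simp [S]⟩
  exact (hm i (Finset.mem_univ i)).trans (nonpos_of_mul_nonpos_right card_mul_max card_pos)

theorem exists_netInflow_eq_iff_forall_cut [Fintype V] (src tgt : E → V) {d : V → ℝ}
    (hd : ∑ i, d i = 0) {l u : E → ℝ} (hlu : l ≤ u) :
    (∃ f ∈ Set.Icc l u, netInflow src tgt f = d) ↔
      ∀ S : Finset V, ∑ i ∈ S, d i ≤
        ∑ a with src a ∉ S ∧ tgt a ∈ S, u a - ∑ a with src a ∈ S ∧ tgt a ∉ S, l a := by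
  constructor
  · rintro ⟨f, hf, rfl⟩ S
    rw [sum_netInflow]
    exact sub_le_sub (Finset.sum_le_sum fun a _ => hf.2 a) (Finset.sum_le_sum fun a _ => hf.1 a)
  · intro hcut
    obtain ⟨f, hf, e, he, hslack⟩ := exists_flow_complementary_slackness src tgt d hlu
    have residual_nonpos := residual_nonpos_of_complementary_slackness he hslack hcut
    have residual_sum : ∑ i, e i = 0 := by simp [he, hd, sum_univ_netInflow]
    have residual_eq_zero : e = 0 := funext fun i =>
      (Finset.sum_eq_zero_iff_of_nonpos fun i _ => residual_nonpos i).1 residual_sum i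
        (Finset.mem_univ i)
    exact ⟨f, hf, (sub_eq_zero.1 (he.symm.trans residual_eq_zero)).symm⟩

end Flow

section CompleteDigraph

variable {V M R : Type*} [Fintype V] [DecidableEq V]

lemma netInflow_arc [Ring R] (f : Arc V → R) (i : V) :
    netInflow (fun a : Arc V => a.1.1) (fun a => a.1.2) f i =
      ∑ a ∈ deltaIn {i}, f a - ∑ a ∈ deltaOut {i}, f a := by
  simpa [deltaIn, deltaOut] using
    sum_netInflow (fun a : Arc V => a.1.1) (fun a => a.1.2) f {i}

lemma sum_deltaIn_sub_sum_deltaOut [Ring R] (f : Arc V → R) (S : Finset V) :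
    ∑ a ∈ deltaIn S, f a - ∑ a ∈ deltaOut S, f a =
      ∑ i ∈ S, (∑ a ∈ deltaIn {i}, f a - ∑ a ∈ deltaOut {i}, f a) := by
  simp only [← netInflow_arc]
  exact (sum_netInflow _ _ f S).symm

lemma sum_arcsIn_add_sum_deltaOut [AddCommMonoid M] (x : Arc V → M) (S : Finset V) :
    ∑ a ∈ arcsIn S, x a + ∑ a ∈ deltaOut S, x a = ∑ i ∈ S, ∑ a ∈ deltaOut {i}, x a := by
  have deltaOut_singleton (i : V) : deltaOut {i} = ({a | a.1.1 = i} : Finset (Arc V)) := by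
    ext a
    simp only [deltaOut, Finset.mem_filter_univ, Finset.mem_singleton, and_iff_left_iff_imp]
    exact fun hs ht => a.2 (hs.trans ht.symm)
  simp only [deltaOut_singleton]
  simp only [arcsIn, deltaOut, Finset.sum_filter]
  rw [Finset.sum_comm, ← Finset.sum_add_distrib]
  refine Finset.sum_congr rfl fun a _ => ?_
  by_cases hs : a.1.1 ∈ S <;> by_cases ht : a.1.2 ∈ S <;> simp [hs, ht]

end CompleteDigraph

section Nodes

variable {V M : Type*} {r : V}

lemma sum_nodes [AddCommMonoid M] (S : Finset (N1 r)) (g : V → M) :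
    ∑ i ∈ nodes S, g i = ∑ i ∈ S, g i.1 := by
  simp [nodes]

lemma exists_nodes_eq {S : Finset V} (hr : r ∉ S) : ∃ T : Finset (N1 r), nodes T = S := by
  classical
  refine ⟨S.subtype fun i => i ≠ r, ?_⟩
  rw [nodes, Finset.subtype_map, Finset.filter_eq_self]
  exact fun i hi => ne_of_mem_of_not_mem hi hr

end Nodes

section AssignmentPolytope

variable {V : Type*} [Fintype V] [DecidableEq V] {x : Arc V → ℝ}

lemma sum_deltaIn_eq_sum_deltaOut_of_mem_PAP (hx : x ∈ PAP V) (S : Finset V) :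
    ∑ a ∈ deltaIn S, x a = ∑ a ∈ deltaOut S, x a := by
  rw [← sub_eq_zero, sum_deltaIn_sub_sum_deltaOut]
  exact Finset.sum_eq_zero fun i _ => by rw [hx.2.1, hx.2.2, sub_self]

lemma sum_arcsIn_add_sum_deltaOut_of_mem_PAP (hx : x ∈ PAP V) (S : Finset V) :
    ∑ a ∈ arcsIn S, x a + ∑ a ∈ deltaOut S, x a = S.card := by
  simp [sum_arcsIn_add_sum_deltaOut, hx.2.1]

lemma le_sum_deltaOut_iff_sum_arcsIn_le (hx : x ∈ PAP V) (S : Finset V) (β : ℝ) :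
    β ≤ ∑ a ∈ deltaOut S, x a ↔ ∑ a ∈ arcsIn S, x a ≤ S.card - β := by
  rw [← sum_arcsIn_add_sum_deltaOut_of_mem_PAP hx S, add_sub_assoc, le_add_iff_nonneg_right,
    sub_nonneg]

end AssignmentPolytope

section Demand

variable {V : Type*} [DecidableEq V] {r : V} {b : N1 r → ℝ}

/-- The demand vector of the single-commodity flow: `b` on `N₁`, and `-1` at the node `r`, which
supplies one unit. -/
def demand (b : N1 r → ℝ) (i : V) : ℝ :=
  if h : i = r then -1 else b ⟨i, h⟩

@[simp]
lemma demand_root (b : N1 r → ℝ) : demand b r = -1 := by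
  simp [demand]

@[simp]
lemma demand_coe (b : N1 r → ℝ) (i : N1 r) : demand b i = b i := by
  simp [demand, i.2]

lemma sum_nodes_demand (b : N1 r → ℝ) (S : Finset (N1 r)) :
    ∑ i ∈ nodes S, demand b i = ∑ i ∈ S, b i := by
  simp [sum_nodes]

variable [Fintype V]

lemma sum_demand_eq_zero (hb : b ∈ Bbar r) : ∑ i, demand b i = 0 := by
  simp [Fintype.sum_eq_add_sum_subtype_ne _ r, hb.2]

lemma sum_demand_nonpos_of_root_mem (hb : b ∈ Bbar r) {S : Finset V} (hr : r ∈ S) :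
    ∑ i ∈ S, demand b i ≤ 0 := by
  obtain ⟨T, hT⟩ := exists_nodes_eq (S := Sᶜ) (by simpa using hr)
  have hcompl : 0 ≤ ∑ i ∈ Sᶜ, demand b i := by
    rw [← hT, sum_nodes_demand]
    exact Finset.sum_nonneg fun i _ => hb.1 i
  linarith [Finset.sum_add_sum_compl S (demand b), sum_demand_eq_zero hb]

end Demand

section SingleCommodityFlow

variable {V : Type*} [Fintype V] [DecidableEq V] {r : V} {b : N1 r → ℝ} {x : Arc V → ℝ}

lemma mem_PSCF_iff_exists_netInflow_eq_demand :
    x ∈ PSCF r b ↔ x ∈ PAP V ∧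
      ∃ f ∈ Set.Icc 0 x, netInflow (fun a : Arc V => a.1.1) (fun a => a.1.2) f = demand b := by
  have balance_iff (f : Arc V → ℝ) :
      netInflow (fun a : Arc V => a.1.1) (fun a => a.1.2) f = demand b ↔
        (∑ a ∈ deltaOut {r}, f a - ∑ a ∈ deltaIn {r}, f a = 1) ∧
        ∀ i : N1 r, ∑ a ∈ deltaOut {i.1}, f a - ∑ a ∈ deltaIn {i.1}, f a = -b i := by
    simp only [funext_iff, netInflow_arc]
    constructor
    · intro h
      exact ⟨by linarith [h r, demand_root b], fun i => by linarith [h i, demand_coe b i]⟩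
    · rintro ⟨hroot, hrest⟩ i
      obtain rfl | hi := eq_or_ne i r
      · linarith [demand_root b]
      · linarith [hrest ⟨i, hi⟩, demand_coe b ⟨i, hi⟩]
  constructor
  · rintro ⟨⟨x, f⟩, ⟨hx, hf, hroot, hrest, hfx⟩, rfl⟩
    exact ⟨hx, f, ⟨hf, hfx⟩, (balance_iff f).2 ⟨hroot, hrest⟩⟩
  · rintro ⟨hx, f, ⟨hf, hfx⟩, hbal⟩
    obtain ⟨hroot, hrest⟩ := (balance_iff f).1 hbal
    exact ⟨(x, f), ⟨hx, hf, hroot, hrest, hfx⟩, rfl⟩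

lemma sum_le_sum_deltaOut_of_card_le_one (hb : b ∈ Bbar r) (hx : x ∈ PAP V) {S : Finset (N1 r)}
    (hS : S.card ≤ 1) : ∑ i ∈ S, b i ≤ ∑ a ∈ deltaOut (nodes S), x a := by
  obtain rfl | ⟨i, rfl⟩ : S = ∅ ∨ ∃ i, S = {i} := by
    rwa [← Finset.card_eq_zero, ← Finset.card_eq_one, ← Nat.le_one_iff_eq_zero_or_eq_one]
  · simp [nodes, deltaOut]
  · have hi : b i ≤ 1 := hb.2 ▸ Finset.single_le_sum (fun j _ => hb.1 j) (Finset.mem_univ i)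
    simpa [nodes, hx.2.1] using hi

lemma forall_sum_demand_le_iff_forall_mem_S1 (hb : b ∈ Bbar r) (hx : x ∈ PAP V) :
    (∀ S : Finset V, ∑ i ∈ S, demand b i ≤ ∑ a ∈ deltaIn S, x a) ↔
      ∀ S ∈ S1 r, ∑ a ∈ deltaOut (nodes S), x a ≥ ∑ i ∈ S, b i := by
  simp only [sum_deltaIn_eq_sum_deltaOut_of_mem_PAP hx]
  constructor
  · intro h S _
    exact (sum_nodes_demand b S).symm.trans_le (h (nodes S))
  · intro h S
    by_cases hr : r ∈ S
    · exact (sum_demand_nonpos_of_root_mem hb hr).trans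
        (Finset.sum_nonneg fun a _ => (hx.1 a).1)
    · obtain ⟨T, rfl⟩ := exists_nodes_eq hr
      rw [sum_nodes_demand]
      obtain hT | hT := le_or_gt T.card 1
      · exact sum_le_sum_deltaOut_of_card_le_one hb hx hT
      · exact h T hT

theorem PSCF_eq_forall_deltaOut_ge (hb : b ∈ Bbar r) :
    PSCF r b = {x | x ∈ PAP V ∧
      ∀ S ∈ S1 r, ∑ a ∈ deltaOut (nodes S), x a ≥ ∑ i ∈ S, b i} := by
  ext x
  rw [mem_PSCF_iff_exists_netInflow_eq_demand]
  refine and_congr_right fun hx => ?_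
  rw [← forall_sum_demand_le_iff_forall_mem_S1 hb hx,
    exists_netInflow_eq_iff_forall_cut _ _ (sum_demand_eq_zero hb) (l := 0) fun a => (hx.1 a).1]
  simp [deltaIn]

lemma deltaOut_nodes_ge_iff_arcsIn_nodes_le (hx : x ∈ PAP V) (b : N1 r → ℝ)
    (S : Finset (N1 r)) :
    ∑ a ∈ deltaOut (nodes S), x a ≥ ∑ i ∈ S, b i ↔
      ∑ a ∈ arcsIn (nodes S), x a ≤ (S.card : ℝ) - ∑ i ∈ S, b i := by
  simpa [nodes] using le_sum_deltaOut_iff_sum_arcsIn_le hx (nodes S) (∑ i ∈ S, b i)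

theorem PSCF_eq_forall_arcsIn_le (hb : b ∈ Bbar r) :
    PSCF r b = {x | x ∈ PAP V ∧
      ∀ S ∈ S1 r, ∑ a ∈ arcsIn (nodes S), x a ≤ (S.card : ℝ) - ∑ i ∈ S, b i} := by
  rw [PSCF_eq_forall_deltaOut_ge hb]
  ext x
  exact and_congr_right fun hx =>
    forall₂_congr fun S _ => deltaOut_nodes_ge_iff_arcsIn_nodes_le hx b S

end SingleCommodityFlow

lemma sum_uniformB {V : Type*} [Fintype V] {r : V} (S : Finset (N1 r)) :
    ∑ i ∈ S, uniformB r i = (S.card : ℝ) / ((Fintype.card V : ℝ) - 1) := by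
  simp [uniformB, div_eq_mul_inv]

lemma uniformB_mem_Bbar {V : Type*} [Fintype V] [DecidableEq V] (hV : 1 < Fintype.card V)
    (r : V) : uniformB r ∈ Bbar r := by
  have hpos : (0 : ℝ) < (Fintype.card V : ℝ) - 1 := sub_pos.2 (by exact_mod_cast hV)
  have hcard : (Fintype.card (N1 r) : ℝ) = Fintype.card V - 1 := by
    rw [Fintype.card_subtype_compl, Fintype.card_subtype_eq, Nat.cast_sub hV.le, Nat.cast_one]
  refine ⟨fun i => (one_div_pos.2 hpos).le, ?_⟩
  rw [sum_uniformB, Finset.card_univ, hcard, div_self hpos.ne']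

theorem mainTheorem7 {V : Type*} [Fintype V] [DecidableEq V] (hn : 4 ≤ Fintype.card V) (r : V) :
    (∀ b ∈ Bbar r,
      PSCF r b = {x | x ∈ PAP V ∧
        ∀ S ∈ S1 r, ∑ a ∈ deltaOut (nodes S), x a ≥ ∑ i ∈ S, b i} ∧
      (∀ x ∈ PAP V, ∀ S ∈ S1 r,
        (∑ a ∈ deltaOut (nodes S), x a ≥ ∑ i ∈ S, b i ↔
          ∑ a ∈ arcsIn (nodes S), x a ≤ (S.card : ℝ) - ∑ i ∈ S, b i)) ∧
      PSCF r b = {x | x ∈ PAP V ∧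
        ∀ S ∈ S1 r, ∑ a ∈ arcsIn (nodes S), x a ≤ (S.card : ℝ) - ∑ i ∈ S, b i}) ∧
    (uniformB r ∈ Bbar r ∧
      (∀ S ∈ S1 r, (S.card : ℝ) - ∑ i ∈ S, uniformB r i =
        (S.card : ℝ) - (S.card : ℝ) / ((Fintype.card V : ℝ) - 1)) ∧
      PSCF r (uniformB r) = {x | x ∈ PAP V ∧
        ∀ S ∈ S1 r, ∑ a ∈ arcsIn (nodes S), x a ≤
          (S.card : ℝ) - (S.card : ℝ) / ((Fintype.card V : ℝ) - 1)}) := by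
  have hu : uniformB r ∈ Bbar r := uniformB_mem_Bbar (by omega) r
  refine ⟨fun b hb => ⟨PSCF_eq_forall_deltaOut_ge hb,
    fun x hx S _ => deltaOut_nodes_ge_iff_arcsIn_nodes_le hx b S, PSCF_eq_forall_arcsIn_le hb⟩,
    hu, fun S _ => by rw [sum_uniformB], ?_⟩
  simpa only [sum_uniformB] using PSCF_eq_forall_arcsIn_le hu
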